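/- Let $\mathbb{R}_{\max}=\mathbb{R}\cup\{-\infty\}$, and write $\bot$ for the vector of $(\mathbb{R}_{\max})^n$ with all entries $-\infty$. Hilbert's projective metric is $d(x,y)=\inf\{s-t \mid s,t\in\mathbb{R},\ t+y_i\le x_i\le s+y_i \text{ for all } i\in[n]\}\in[0,+\infty]$ (with $\inf\emptyset=+\infty$) if $x,y\in(\mathbb{R}_{\max})^n$ are not both $\bot$, and $d(\bot,\bot)=0$. For sets $A,B\subset(\mathbb{R}_{\max})^n$ put $\operatorname{dist}_H(A,B)=\sup_{x\in A}\inf_{y\in B}d(x,y)$. A tropical cone is a subset of $(\mathbb{R}_{\max})^n$ that is stable under entrywise maximum and under addition of a scalar of $\mathbb{R}_{\max}$ to all entries, and $\operatorname{Span}(\mathcal{V})$ is the smallest tropical cone containing $\mathcal{V}$. Let $I,J\subset[n]$ be nonempty and disjoint with $I\cup J=[n]$, and let $\mathcal{V}\subset(\mathbb{R}_{\max})^n$ be a finite set such that for every $l\in[n]$ some $v\in\mathcal{V}$ has $v_l\ne-\infty$. For $a\ne\bot$ let $$\mathcal{H}^{IJ}_a=\{x\in(\mathbb{R}_{\max})^n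 \mid \max_{i\in I}(a_i+x_i)=\max_{j\in J}(a_j+x_j)\},$$ and define $T^{IJ}:(\mathbb{R}_{\max})^n\to(\mathbb{R}_{\max})^n$ by $$T^{IJ}_l(x)=\min_{v\in\mathcal{V},\,v_l\neq-\infty}\Big(-v_l+\max_{k\in K(l)}(v_k+x_k)\Big),\qquad K(l)=J \text{ if } l\in I,\quad K(l)=I \text{ if } l\in J.$$ Let $\rho=\rho(T^{IJ})$ be the supremum of all $\lambda\in\mathbb{R}\cup\{-\infty\}$ such that $T^{IJ}(u)=\lambda+u$ for some $u\in(\mathbb{R}_{\max})^n$, $u\ne\bot$. For $w\in\mathbb{R}^n$ and real $r\ge0$ let $B_{IJ}(w,r)=\{s+w+\mu e^J\mid \mu\in[-r,r],\ s\in\mathbb{R}\}$, where $e^J_l=1$ for $l\in J$ and $e^J_l=0$ for $l\in I$. Theorem. (1) In $[0,+\infty]$, $$\min_{a\in(\mathbb{R}_{\max})^n,\ a\neq\bot}\operatorname{dist}_H(\mathcal{V},\mathcal{H}^{IJ}_a)=-\rho=\sup\{r\ge0\mid \exists w\in\mathbb{R}^n,\ B_{IJ}(w,r)\subset\operatorname{Span}(\mathcal{V})\},$$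 and the minimum is attained. (2) There is a vector $b\in(\mathbb{R}_{\max})^n$, $b\ne\bot$, with $T^{IJ}(b)\ge\rho+b$, and every such $b$ attains the minimum in (1). (3) If $\rho$ is finite, the supremum in (1) is attained. In that case there is a vector $u\in\mathbb{R}^n$ with $T^{IJ}(u)\le\rho+u$. Moreover, for every such $u$ there is a choice, for each $l\in[n]$, of a vector $\sigma(l)\in\mathcal{V}$ with $\sigma(l)_l\ne-\infty$ that attains the minimum defining $T^{IJ}_l(u)$; and for every such $u$ and every such choice, the vector $c$ with entries $$c_l=\max_{k\in I}\big(-u_k-\sigma(k)_k+\sigma(k)_l\big)\ \ (l\in I),\qquad c_l=\max_{k\in J}\big(-u_k-\sigma(k)_k+\sigma(k)_l\big)\ \ (l\in J)$$ belongs to $\mathbb{R}^n$ and satisfies $B_{IJ}(c,-\rho)\subset\operatorname{Span}(\mathcal{V})$. -/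

import Mathlib

/-- The ground set `ℝ ∪ {-∞}` of the max-plus semifield: `⊔` is the tropical sum, `+` is the
tropical product, and `⊥` stands for `-∞` (with `⊥ + x = ⊥`). -/
abbrev Rmax : Type := WithBot ℝ

namespace Rmax

/-- The inclusion of `ℝ ∪ {-∞}` in `[-∞, +∞]`. -/
noncomputable def toEReal : Rmax → EReal :=
  WithBot.recBotCoe ⊥ (fun r : ℝ => (r : EReal))

/-- The scalar `-a` of an element `a ≠ -∞` (it is only used for such `a`). -/
noncomputable def opp (a : Rmax) : ℝ := -(WithBot.unbotD 0 a)

end Rmax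

namespace TropicalRegression

/-- A tropical cone (tropical submodule) of `(ℝ ∪ {-∞})ⁿ`. -/
def IsTropicalCone {n : ℕ} (C : Set (Fin n → Rmax)) : Prop :=
  ∀ x ∈ C, ∀ y ∈ C, ∀ α : Rmax, (fun l => α + x l) ∈ C ∧ x ⊔ y ∈ C

/-- The smallest tropical cone that contains `V`. -/
def tropicalSpan {n : ℕ} (V : Set (Fin n → Rmax)) : Set (Fin n → Rmax) :=
  ⋂₀ {C | IsTropicalCone C ∧ V ⊆ C}

open Classical in
/-- Hilbert's projective metric, with values in `[0, +∞]`: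
`d(x, y) = inf {s - t | t + y ≤ x ≤ s + y}`, the infimum of the empty set being `+∞`, and
`d(⊥, ⊥) = 0` by convention. -/
noncomputable def hilbertDist {n : ℕ} (x y : Fin n → Rmax) : EReal :=
  if x = ⊥ ∧ y = ⊥ then 0
  else sInf {c : EReal | ∃ s t : ℝ, c = ((s - t : ℝ) : EReal) ∧
    ∀ l, (t : Rmax) + y l ≤ x l ∧ x l ≤ (s : Rmax) + y l}

/-- Hilbert's distance from a set `A` to a set `B` (one-sided Hausdorff distance). -/
noncomputable def hilbertDistSet {n : ℕ} (A B : Set (Fin n → Rmax)) : EReal :=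
  ⨆ a ∈ A, ⨅ b ∈ B, hilbertDist a b

/-- The signed tropical hyperplane of type `(I, J)` with parameter `a`. -/
def signedHyperplane {n : ℕ} (I J : Finset (Fin n)) (a : Fin n → Rmax) : Set (Fin n → Rmax) :=
  {x | I.sup (fun i => a i + x i) = J.sup (fun j => a j + x j)}

/-- The side to which `l` does not belong: `J` if `l ∈ I`, and `I` otherwise. -/
def otherSide {n : ℕ} (I J : Finset (Fin n)) (l : Fin n) : Finset (Fin n) :=
  if l ∈ I then J else I

/-- The quantity `-v_l + max_k (v_k + x_k)`, where `k` runs over the side opposite to `l`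
(it is only used when `v_l ≠ -∞`). -/
noncomputable def payoff {n : ℕ} (I J : Finset (Fin n)) (x : Fin n → Rmax) (l : Fin n)
    (v : Fin n → Rmax) : Rmax :=
  ((v l).opp : Rmax) + (otherSide I J l).sup (fun k => v k + x k)

open Classical in
/-- The Shapley operator `T^{IJ}` of a finite set `V` of vectors such that every coordinate is
finite in some element of `V`. -/
noncomputable def signedOperator {n : ℕ} (I J : Finset (Fin n)) (V : Finset (Fin n → Rmax))
    (hV : ∀ l, ∃ v ∈ V, v l ≠ ⊥) (x : Fin n → Rmax) : Fin n → Rmax := fun l =>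
  (V.filter (fun v => v l ≠ ⊥)).inf'
    (let ⟨v, hv, hl⟩ := hV l; ⟨v, Finset.mem_filter.mpr ⟨hv, hl⟩⟩)
    (payoff I J x l)

/-- The spectral radius of a self-map `T` of `(ℝ ∪ {-∞})ⁿ`: the supremum of its eigenvalues
`α ∈ ℝ ∪ {-∞}`, that is, of the `α` such that `T(u) = α + u` for some `u ≠ ⊥`. -/
noncomputable def spectralRad {n : ℕ} (T : (Fin n → Rmax) → (Fin n → Rmax)) : EReal :=
  sSup {c : EReal | ∃ α : Rmax, c = α.toEReal ∧
    ∃ u : Fin n → Rmax, u ≠ ⊥ ∧ T u = fun l => α + u l}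

/-- A vector with real entries, seen as a vector of `(ℝ ∪ {-∞})ⁿ`. -/
def ofReal {n : ℕ} (u : Fin n → ℝ) : Fin n → Rmax := fun l => (u l : Rmax)

/-- The vertical interval `{s + w + μ e^J | μ ∈ [-r, r], s ∈ ℝ}` with center `w` and
radius `r`. -/
def verticalInterval {n : ℕ} (J : Finset (Fin n)) (w : Fin n → ℝ) (r : ℝ) :
    Set (Fin n → Rmax) :=
  {x | ∃ s μ : ℝ, -r ≤ μ ∧ μ ≤ r ∧ x = ofReal (fun l => s + w l + μ * (if l ∈ J then 1 else 0))}

/-- `σ` selects, for every coordinate `l`, an element of `V` that attains the minimum which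
defines the `l`-th entry of `T^{IJ}(x)`. -/
def IsMinimizer {n : ℕ} (I J : Finset (Fin n)) (V : Finset (Fin n → Rmax))
    (hV : ∀ l, ∃ v ∈ V, v l ≠ ⊥) (x : Fin n → Rmax) (σ : Fin n → (Fin n → Rmax)) : Prop :=
  ∀ l, σ l ∈ V ∧ σ l l ≠ ⊥ ∧ signedOperator I J V hV x l = payoff I J x l (σ l)

/-- The vector `c` built from a finite vector `u` and a selection `σ`:
`c_l = max_k (-u_k - σ(k)_k + σ(k)_l)`, where `k` runs over the side (`I` or `J`) of `l`. -/
noncomputable def center {n : ℕ} (I J : Finset (Fin n)) (u : Fin n → ℝ)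
    (σ : Fin n → (Fin n → Rmax)) : Fin n → Rmax := fun l =>
  (if l ∈ I then I else J).sup (fun k => ((-(u k) + (σ k k).opp : ℝ) : Rmax) + σ k l)

end TropicalRegression

/-! The theorem is a duality between super- and sub-eigenvectors of `T = T^{IJ}`.

Clearing denominators, `T(b) ≥ α + b` says that the two tropical forms with coefficients `b`
supported by `I` and `J` differ by at most `-α` on every `v ∈ V` (`super_iff_isBalanced`). For `α ≤
0` this means that `V` lies within Hilbert distance `-α` of the hyperplane of `b`
(`hilbertDistSet_le_iff`). Dually, a finite `u` with `T(u) ≤ α + u` produces a vertical interval of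
radius `-α` in the span (`verticalInterval_center_subset`). Weak duality, `super_le_neg_radius`:
balance passes from `V` to its span, and no interval of radius greater than `-α` is balanced.

It remains to close the gap. For each real `α` there is a nontrivial super-eigenvector for `α` or a
finite sub-eigenvector for a smaller scalar (`exists_super_or_sub`), so both problems have the same
critical value. The supremum on the super side is attained by this dichotomy; the infimum on the sub
side is attained because `T` is a minimum of finitely many policies, each giving a system of
difference constraints (`exists_potential`). Between the two vectors a Knaster–Tarski argument finds
an eigenvector, so the critical value is `ρ`. If no real super-eigenvalue exists, then `ρ = -∞`, all
distances are infinite and the radii are unbounded. -/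

namespace Rmax

theorem coe_add_le_iff (c : ℝ) (a b : Rmax) : (c : Rmax) + a ≤ b ↔ a ≤ ((-c : ℝ) : Rmax) + b := by
  induction a using WithBot.recBotCoe with
  | bot => simp
  | coe a =>
    induction b using WithBot.recBotCoe with
    | bot => simp [← WithBot.coe_add]
    | coe b =>
      norm_cast
      constructor <;> intro h <;> linarith

theorem le_coe_add_iff (c : ℝ) (a b : Rmax) : a ≤ (c : Rmax) + b ↔ ((-c : ℝ) : Rmax) + a ≤ b := by
  rw [coe_add_le_iff, neg_neg]

theorem coe_add_coe_add (c d : ℝ) (a : Rmax) :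
    (c : Rmax) + ((d : Rmax) + a) = ((c + d : ℝ) : Rmax) + a := by
  rw [← add_assoc, ← WithBot.coe_add]

theorem add_finset_sup {ι : Type*} (s : Finset ι) (f : ι → Rmax) (c : Rmax) :
    c + s.sup f = s.sup (fun i => c + f i) := by
  refine Finset.apply_sup_eq_sup_comp (fun x => c + x) (fun x y => ?_) (by simp)
  exact (add_right_mono (a := c)).map_sup x y

theorem coe_opp {a : Rmax} (ha : a ≠ ⊥) : (a.opp : Rmax) + a = 0 := by
  induction a using WithBot.recBotCoe with
  | bot => exact absurd rfl ha
  | coe a => simp [opp, ← WithBot.coe_add]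

theorem coe_neg_opp {a : Rmax} (ha : a ≠ ⊥) : ((-a.opp : ℝ) : Rmax) = a := by
  induction a using WithBot.recBotCoe with
  | bot => exact absurd rfl ha
  | coe a => simp [opp]

theorem coe_add_ne_bot (c : ℝ) {a : Rmax} (ha : a ≠ ⊥) : (c : Rmax) + a ≠ ⊥ := by
  simp [WithBot.add_eq_bot, ha]

theorem coe_add_le_self_of_nonpos {c : ℝ} (hc : c ≤ 0) (a : Rmax) : (c : Rmax) + a ≤ a := by
  calc (c : Rmax) + a ≤ 0 + a := by gcongr; exact_mod_cast hc
    _ = a := zero_add a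

theorem le_coe_add_of_forall_lt {r : ℝ} {a b : Rmax}
    (h : ∀ r' : ℝ, r < r' → a ≤ (r' : Rmax) + b) : a ≤ (r : Rmax) + b := by
  induction a using WithBot.recBotCoe with
  | bot => simp
  | coe a =>
    induction b using WithBot.recBotCoe with
    | bot => simpa using h (r + 1) (by linarith)
    | coe b =>
      norm_cast at h ⊢
      exact le_of_forall_pos_le_add fun ε hε => by linarith [h (r + ε) (by linarith)]

@[simp] theorem toEReal_bot : toEReal ⊥ = ⊥ := rfl

@[simp] theorem toEReal_coe (r : ℝ) : toEReal (r : Rmax) = (r : EReal) := rfl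

theorem toEReal_le_iff (a b : Rmax) : a.toEReal ≤ b.toEReal ↔ a ≤ b := by
  induction a using WithBot.recBotCoe with
  | bot => simp
  | coe a =>
    induction b using WithBot.recBotCoe with
    | bot => simp
    | coe b => simp

theorem toEReal_coe_add (c : ℝ) (a : Rmax) :
    toEReal ((c : Rmax) + a) = (c : EReal) + a.toEReal := by
  induction a using WithBot.recBotCoe with
  | bot => simp
  | coe a => exact EReal.coe_add c a

theorem exists_isGLB_range {ι : Type*} [Nonempty ι] (f : ι → Rmax) : ∃ a, IsGLB (Set.range f) a :=
  ⟨_, isGLB_csInf (Set.range_nonempty f) (OrderBot.bddBelow _)⟩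

end Rmax

/-! ### Shapley operators and the super/sub dichotomy -/

namespace TropicalRegression

variable {n : ℕ}

/-- An order-preserving self-map of `(ℝ ∪ {-∞})ⁿ` which commutes with the addition of real
scalars and is continuous along decreasing sequences. -/
structure IsShapley (T : (Fin n → Rmax) → (Fin n → Rmax)) : Prop where
  mono : Monotone T
  hom : ∀ (c : ℝ) (x : Fin n → Rmax) (l : Fin n), T (fun k => (c : Rmax) + x k) l = c + T x l
  cont : ∀ (x : ℕ → Fin n → Rmax) (y : Fin n → Rmax), Antitone x →
    (∀ k, IsGLB (Set.range fun j => x j k) (y k)) →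
    ∀ (l : Fin n) (c : Rmax), (∀ j, c ≤ T (x j) l) → c ≤ T y l

/-- One step of the descent `x ↦ x ⊓ (T x - α)`, where each entry decreases by at most one. -/
noncomputable def descent (T : (Fin n → Rmax) → (Fin n → Rmax)) (α : ℝ) (x : Fin n → Rmax) :
    Fin n → Rmax :=
  fun l => x l ⊓ ((((-α : ℝ) : Rmax) + T x l) ⊔ (((-1 : ℝ) : Rmax) + x l))

namespace IsShapley

variable {T : (Fin n → Rmax) → (Fin n → Rmax)}

theorem descent_mono (hT : IsShapley T) (α : ℝ) : Monotone (descent T α) := by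
  intro x y h l
  have h1 := h l
  have h2 := hT.mono h l
  simp only [descent]
  gcongr

theorem descent_hom (hT : IsShapley T) (α c : ℝ) (x : Fin n → Rmax) (l : Fin n) :
    descent T α (fun k => (c : Rmax) + x k) l = c + descent T α x l := by
  have hm : Monotone fun a : Rmax => (c : Rmax) + a := add_right_mono
  simp only [descent, hT.hom]
  rw [hm.map_inf, hm.map_sup, add_left_comm, add_left_comm (c : Rmax) ((-1 : ℝ) : Rmax)]

theorem descent_le (α : ℝ) (x : Fin n → Rmax) : descent T α x ≤ x := fun _ => inf_le_left

theorem descent_ne_bot (α : ℝ) {x : Fin n → Rmax} (hx : ∀ l, x l ≠ ⊥) (l : Fin n) :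
    descent T α x l ≠ ⊥ := by
  refine ne_bot_of_le_ne_bot (Rmax.coe_add_ne_bot (-1) (hx l)) (le_inf ?_ le_sup_right)
  exact Rmax.coe_add_le_self_of_nonpos (by norm_num) _

/-- Either `T` has a nontrivial `α`-super-eigenvector, or it has a finite sub-eigenvector for a
scalar smaller than `α`. -/
theorem exists_super_or_sub (hT : IsShapley T) (α : ℝ) :
    (∃ b : Fin n → Rmax, b ≠ ⊥ ∧ ∀ l, (α : Rmax) + b l ≤ T b l) ∨
    ∃ δ : ℝ, 0 < δ ∧ ∃ p : Fin n → ℝ, ∀ l, T (ofReal p) l ≤ ((α - δ : ℝ) : Rmax) + p l := by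
  -- The descent is iterated from the zero vector; the two alternatives correspond to whether its
  -- limit `y` is `⊥`. The cap of one per step keeps all iterates finite even where `T` takes the
  -- value `⊥`.
  set S := descent T α with hS
  set x : ℕ → Fin n → Rmax := fun j => S^[j] 0 with hx
  have hsucc : ∀ j, x (j + 1) = S (x j) := fun j => Function.iterate_succ_apply' S j 0
  have hanti : Antitone x := antitone_nat_of_succ_le fun j => by
    rw [hsucc]; exact descent_le α _
  have hfin : ∀ j l, x j l ≠ ⊥ := by
    intro j
    induction j with
    | zero => intro l; simp [hx]
    | succ j ih => intro l; rw [hsucc]; exact descent_ne_bot α ih l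
  choose y hy using fun l => Rmax.exists_isGLB_range fun j => x j l
  by_cases hbot : y = ⊥
  · right
    have hlow : ∀ l, ∃ j, x j l ≤ ((-1 : ℝ) : Rmax) := by
      intro l
      by_contra! h
      have : ((-1 : ℝ) : Rmax) ≤ y l := (hy l).2 (by rintro _ ⟨j, rfl⟩; exact (h j).le)
      simp [hbot] at this
    choose m hm using hlow
    -- The added one makes `N` positive even when `n = 0`.
    set N := Finset.univ.sup m + 1 with hN
    have hNl : ∀ l, x N l ≤ ((-1 : ℝ) : Rmax) := fun l =>
      (hanti ((Finset.le_sup (Finset.mem_univ l)).trans (Nat.le_succ _)) l).trans (hm l)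
    have hN0 : (0 : ℝ) < N := by rw [hN]; positivity
    have hNe : (Finset.range N).Nonempty := ⟨0, by simp [hN]⟩
    -- Tilted minimum over the orbit: `S` moves the term `j` to `j + 1`, a gain of `1 / N`, and the
    -- wrap-around from `N - 1` to `0` is paid for by `x N ≤ -1 = x 0 - 1`.
    set q : Fin n → Rmax := fun l =>
      (Finset.range N).inf' hNe fun j => (((j : ℝ) / N : ℝ) : Rmax) + x j l with hq
    have hqfin : ∀ l, q l ≠ ⊥ := by
      intro l
      obtain ⟨j, -, hj⟩ := Finset.exists_mem_eq_inf' hNe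
        fun j : ℕ => (((j : ℝ) / N : ℝ) : Rmax) + x j l
      rw [hq]
      simp only [hj]
      exact Rmax.coe_add_ne_bot _ (hfin j l)
    have hSq : ∀ l, S q l ≤ ((-(1 / N) : ℝ) : Rmax) + q l := by
      intro l
      have hstep : ∀ j < N, S q l ≤ (((j : ℝ) / N : ℝ) : Rmax) + x (j + 1) l := by
        intro j hj
        rw [hsucc, hS, ← hT.descent_hom]
        exact hT.descent_mono α (fun k => Finset.inf'_le _ (Finset.mem_range.mpr hj)) l
      rw [Rmax.le_coe_add_iff]
      refine Finset.le_inf' _ _ fun j hj => ?_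
      rw [← Rmax.le_coe_add_iff, Rmax.coe_add_coe_add]
      rcases j with _ | j
      · have h1 := hstep (N - 1) (by simp [hN])
        have h2 : N - 1 + 1 = N := by simp [hN]
        rw [h2] at h1
        refine h1.trans ?_
        rw [Nat.cast_sub (by simp [hN])]
        have h3 : x 0 l = ((0 : ℝ) : Rmax) := rfl
        rw [h3]
        refine (add_le_add le_rfl (hNl l)).trans ?_
        rw [← WithBot.coe_add, ← WithBot.coe_add, WithBot.coe_le_coe]
        push_cast
        field_simp
        linarith
      · refine (hstep j (by simp at hj; omega)).trans (le_of_eq ?_)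
        congr 2
        push_cast
        ring
    refine ⟨1 / N, by positivity, fun l => (q l).unbotD 0, fun l => ?_⟩
    have hqe : (ofReal fun l => (q l).unbotD 0) = q := by
      funext l
      obtain ⟨r, hr⟩ := WithBot.ne_bot_iff_exists.mp (hqfin l)
      simp [ofReal, ← hr]
    have hql : (((q l).unbotD 0 : ℝ) : Rmax) = q l := congrFun hqe l
    rw [hqe, hql]
    have h := hSq l
    obtain ⟨r, hr⟩ := WithBot.ne_bot_iff_exists.mp (hqfin l)
    -- As `q l` is finite, `S q ≤ q - 1 / N` cannot come from the term `q l` of the descent, so it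
    -- bounds `T q l - α`.
    rw [hS, descent, inf_le_iff] at h
    rcases h with h | h
    · rw [← hr] at h
      norm_cast at h
      have : (0 : ℝ) < 1 / N := by positivity
      linarith
    · have h' := le_sup_left.trans h
      rw [Rmax.coe_add_le_iff, Rmax.coe_add_coe_add] at h'
      convert h' using 3
      ring
  · left
    refine ⟨y, hbot, fun l => ?_⟩
    refine hT.cont x y hanti hy l _ fun j => ?_
    by_cases hyl : y l = ⊥
    · simp [hyl]
    -- Once the entry is within one of its limit, the cap can no longer be active, and the descent
    -- is governed by `T x - α`.
    have hex : ∃ i, x i l < ((1 : ℝ) : Rmax) + y l := by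
      by_contra! h
      have h1 : ((1 : ℝ) : Rmax) + y l ≤ y l := (hy l).2 (by rintro _ ⟨j, rfl⟩; exact h j)
      obtain ⟨r, hr⟩ := WithBot.ne_bot_iff_exists.mp hyl
      rw [← hr] at h1
      norm_cast at h1
      linarith
    obtain ⟨i, hi⟩ := hex
    refine le_trans ?_ (hT.mono (hanti (le_max_left j i)) l)
    have h1 : y l ≤ x (max j i + 1) l := (hy l).1 ⟨_, rfl⟩
    rw [hsucc, hS, descent, le_inf_iff, le_sup_iff] at h1
    rcases h1.2 with h | h
    · rwa [Rmax.coe_add_le_iff]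
    · rw [Rmax.le_coe_add_iff, neg_neg] at h
      exact absurd (h.trans (hanti (le_max_right j i) l)) (not_le.mpr hi)

end IsShapley
end TropicalRegression

/-! ### Difference constraints -/

namespace TropicalRegression

variable {n : ℕ}

/-- A system of difference constraints that is solvable up to every positive error is
solvable. -/
theorem exists_potential {m : ℕ} (w : Fin m → Fin m → Rmax)
    (h : ∀ ε : ℝ, 0 < ε → ∃ p : Fin m → ℝ, ∀ l k, w l k + (p k : Rmax) ≤ (ε : Rmax) + p l) :
    ∃ p : Fin m → ℝ, ∀ l k, w l k + (p k : Rmax) ≤ p l := by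
  induction m with
  | zero => exact ⟨fun _ => 0, fun l => l.elim0⟩
  | succ m ih =>
    have h0 : w 0 0 ≤ 0 := by
      have : w 0 0 ≤ ((0 : ℝ) : Rmax) + ((0 : ℝ) : Rmax) := by
        refine Rmax.le_coe_add_of_forall_lt fun ε hε => ?_
        obtain ⟨p, hp⟩ := h ε hε
        have := hp 0 0
        cases hw : w 0 0 using WithBot.recBotCoe with
        | bot => simp
        | coe a =>
          rw [hw] at this
          norm_cast at this ⊢
          linarith
      simpa using this
    -- Fourier–Motzkin elimination of the unknown `p 0`: every pair of constraints through `0` is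
    -- composed. The errors add up, hence `ε / 2`.
    obtain ⟨p, hp⟩ := ih
      (fun l k => w l.succ k.succ ⊔ (w l.succ 0 + w 0 k.succ)) (fun ε hε => by
        obtain ⟨p, hp⟩ := h (ε / 2) (by linarith)
        refine ⟨fun l => p l.succ, fun l k => ?_⟩
        have hle : ∀ a : Rmax, ((ε / 2 : ℝ) : Rmax) + a ≤ (ε : Rmax) + a := fun a => by
          gcongr
          exact_mod_cast (by linarith : ε / 2 ≤ ε)
        rw [(add_left_mono (a := (p k.succ : Rmax))).map_sup]
        refine sup_le ((hp _ _).trans (hle _)) ?_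
        calc w l.succ 0 + w 0 k.succ + (p k.succ : Rmax)
            ≤ w l.succ 0 + (((ε / 2 : ℝ) : Rmax) + p 0) := by
              rw [add_assoc]; exact add_le_add le_rfl (hp _ _)
          _ = ((ε / 2 : ℝ) : Rmax) + (w l.succ 0 + p 0) := add_left_comm _ _ _
          _ ≤ ((ε / 2 : ℝ) : Rmax) + (((ε / 2 : ℝ) : Rmax) + p l.succ) := by
              exact add_le_add le_rfl (hp _ _)
          _ = (ε : Rmax) + p l.succ := by rw [Rmax.coe_add_coe_add, add_halves])
    have hp1 : ∀ l k, w l.succ k.succ + (p k : Rmax) ≤ p l := fun l k =>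
      (add_le_add le_sup_left le_rfl).trans (hp l k)
    have hp2 : ∀ l k, w l.succ 0 + (w 0 k.succ + (p k : Rmax)) ≤ p l := fun l k => by
      rw [← add_assoc]
      exact (add_le_add le_sup_right le_rfl).trans (hp l k)
    obtain ⟨t, ht1, ht2⟩ : ∃ t : ℝ, (∀ k, w 0 k.succ + (p k : Rmax) ≤ t) ∧
        ∀ l, w l.succ 0 + (t : Rmax) ≤ p l := by
      set M : Rmax := Finset.univ.sup fun k : Fin m => w 0 k.succ + (p k : Rmax) with hM
      have hMk : ∀ k, w 0 k.succ + (p k : Rmax) ≤ M := fun k =>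
        Finset.le_sup (f := fun k : Fin m => w 0 k.succ + (p k : Rmax)) (Finset.mem_univ k)
      by_cases hb : M = ⊥
      -- Nothing bounds `p 0` from below, so any small enough value works; the default of `opp` at
      -- `⊥` only adds a harmless bound.
      · obtain ⟨t, ht⟩ := (Set.finite_range fun l => (w l.succ 0).opp + p l).bddBelow
        refine ⟨t, fun k => (hMk k).trans (by simp [hb]), fun l => ?_⟩
        have := ht ⟨l, rfl⟩
        cases hw : w l.succ 0 using WithBot.recBotCoe with
        | bot => simp
        | coe a =>
          simp only [hw, Rmax.opp, WithBot.unbotD_coe] at this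
          norm_cast
          linarith
      · obtain ⟨t, ht⟩ := WithBot.ne_bot_iff_exists.mp hb
        refine ⟨t, fun k => (hMk k).trans ht.ge, fun l => ?_⟩
        rw [ht, hM, Rmax.add_finset_sup]
        exact Finset.sup_le fun k _ => hp2 l k
    refine ⟨Fin.cons t p, fun l k => ?_⟩
    refine Fin.cases ?_ (fun l => ?_) l <;> refine Fin.cases ?_ (fun k => ?_) k
    · simpa using add_le_add h0 (le_refl (t : Rmax))
    · simpa using ht1 k
    · simpa using ht2 l
    · simpa using hp1 l k

/-! ### Comparison and existence of eigenvectors -/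

namespace IsShapley

variable {T : (Fin n → Rmax) → (Fin n → Rmax)}

/-- Touching argument: shift `p` until it lies above `b` and meets it at a coordinate `l` where `b -
p` is largest, then compare `T` at that coordinate. -/
theorem super_le_sub (hT : IsShapley T) {α β : ℝ} {b : Fin n → Rmax} {p : Fin n → ℝ} (hb : b ≠ ⊥)
    (hα : ∀ l, (α : Rmax) + b l ≤ T b l) (hβ : ∀ l, T (ofReal p) l ≤ (β : Rmax) + p l) : α ≤ β := by
  obtain ⟨i, hi⟩ := Function.ne_iff.mp hb
  have : Nonempty (Fin n) := ⟨i⟩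
  obtain ⟨l, hl⟩ := Finite.exists_max fun l => ((-p l : ℝ) : Rmax) + b l
  have hl0 : ((-p l : ℝ) : Rmax) + b l ≠ ⊥ :=
    ne_bot_of_le_ne_bot (Rmax.coe_add_ne_bot _ hi) (hl i)
  obtain ⟨s, hs⟩ := WithBot.ne_bot_iff_exists.mp hl0
  have hle : b ≤ fun k => (s : Rmax) + ofReal p k := fun k => by
    have := hl k
    rw [← hs, ← Rmax.le_coe_add_iff, add_comm] at this
    exact this
  have hbl : b l = (s : Rmax) + p l := by
    rw [hs, add_right_comm, ← WithBot.coe_add]; simp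
  have h := (hα l).trans ((hT.mono hle l).trans ((hT.hom s _ l).trans_le
    (add_le_add le_rfl (hβ l))))
  rw [hbl] at h
  norm_cast at h
  linarith

/-- Knaster–Tarski for `x ↦ T x - α` on the order interval from `b` to a shift `q` of `p` above `b`;
the supremum of the super-eigenvectors in it is fixed. -/
theorem exists_eigenvector (hT : IsShapley T) {α : ℝ} {b : Fin n → Rmax} {p : Fin n → ℝ}
    (hb : b ≠ ⊥) (hα : ∀ l, (α : Rmax) + b l ≤ T b l)
    (hβ : ∀ l, T (ofReal p) l ≤ (α : Rmax) + p l) :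
    ∃ u : Fin n → Rmax, u ≠ ⊥ ∧ T u = fun l => (α : Rmax) + u l := by
  obtain ⟨s, hs⟩ := (Set.finite_range fun l => (b l).unbotD 0 - p l).bddAbove
  set q : Fin n → Rmax := fun l => (s : Rmax) + ofReal p l with hq
  have hbq : b ≤ q := fun l => by
    have h := hs ⟨l, rfl⟩
    simp only [hq, ofReal]
    cases hbl : b l using WithBot.recBotCoe with
    | bot => simp
    | coe r =>
      simp only [hbl, WithBot.unbotD_coe] at h
      norm_cast
      linarith
  have hTq : ∀ l, T q l ≤ (α : Rmax) + q l := fun l => by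
    rw [hq, hT.hom, add_left_comm]
    gcongr
    exact hβ l
  set A : Set (Fin n → Rmax) := {x | b ≤ x ∧ x ≤ q ∧ ∀ l, (α : Rmax) + x l ≤ T x l} with hA
  have hu : IsLUB A (sSup A) := isLUB_csSup ⟨b, le_rfl, hbq, hα⟩ ⟨q, fun x hx => hx.2.1⟩
  set u := sSup A
  set z : Fin n → Rmax := fun l => ((-α : ℝ) : Rmax) + T u l with hz
  have huz : u ≤ z := hu.2 fun x hx l => by
    rw [hz, ← Rmax.coe_add_le_iff]
    exact (hx.2.2 l).trans (hT.mono (hu.1 hx) l)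
  have hbu : b ≤ u := hu.1 ⟨le_rfl, hbq, hα⟩
  have hzu : z ≤ u := hu.1 ⟨hbu.trans huz, fun l => by
    rw [hz, Rmax.coe_add_le_iff, neg_neg]
    exact (hT.mono (hu.2 fun x hx => hx.2.1) l).trans (hTq l), fun l => by
    rw [hz, Rmax.coe_add_coe_add]
    simpa using hT.mono huz l⟩
  refine ⟨u, fun h => hb (le_bot_iff.mp (h ▸ hbu)), funext fun l => ?_⟩
  have := congrFun (le_antisymm huz hzu) l
  rw [this, hz, Rmax.coe_add_coe_add]
  simp

end IsShapley

/-! ### The operator `T^{IJ}`: continuity, policies, balance -/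

theorem le_signedOperator_iff {I J : Finset (Fin n)} {V : Finset (Fin n → Rmax)}
    {hV : ∀ l, ∃ v ∈ V, v l ≠ ⊥} {x : Fin n → Rmax} {l : Fin n} {c : Rmax} :
    c ≤ signedOperator I J V hV x l ↔ ∀ v ∈ V, v l ≠ ⊥ → c ≤ payoff I J x l v := by
  simp [signedOperator, Finset.le_inf'_iff]

theorem signedOperator_le {I J : Finset (Fin n)} {V : Finset (Fin n → Rmax)}
    (hV : ∀ l, ∃ v ∈ V, v l ≠ ⊥) (x : Fin n → Rmax) {l : Fin n} {v : Fin n → Rmax}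
    (hv : v ∈ V) (hl : v l ≠ ⊥) : signedOperator I J V hV x l ≤ payoff I J x l v :=
  le_signedOperator_iff.mp le_rfl v hv hl

theorem exists_isMinimizer (I J : Finset (Fin n)) (V : Finset (Fin n → Rmax))
    (hV : ∀ l, ∃ v ∈ V, v l ≠ ⊥) (x : Fin n → Rmax) :
    ∃ σ : Fin n → (Fin n → Rmax), IsMinimizer I J V hV x σ := by
  classical
  have h : ∀ l, ∃ v, v ∈ V ∧ v l ≠ ⊥ ∧ signedOperator I J V hV x l = payoff I J x l v := by
    intro l
    obtain ⟨v, hv, h⟩ := Finset.exists_mem_eq_inf' (s := V.filter fun v => v l ≠ ⊥)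
      (let ⟨v, hv, hl⟩ := hV l; ⟨v, Finset.mem_filter.mpr ⟨hv, hl⟩⟩) (payoff I J x l)
    rw [Finset.mem_filter] at hv
    refine ⟨v, hv.1, hv.2, ?_⟩
    rw [← h, signedOperator]
  choose σ h using h
  exact ⟨σ, h⟩

theorem isShapley_signedOperator (I J : Finset (Fin n)) (V : Finset (Fin n → Rmax))
    (hV : ∀ l, ∃ v ∈ V, v l ≠ ⊥) : IsShapley (signedOperator I J V hV) where
  mono x y h l := by
    refine le_signedOperator_iff.mpr fun v hv hl => (signedOperator_le hV x hv hl).trans ?_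
    exact add_le_add le_rfl (Finset.sup_mono_fun fun k _ => add_le_add le_rfl (h k))
  hom c x l := by
    have hpay : ∀ v, payoff I J (fun k => (c : Rmax) + x k) l v = c + payoff I J x l v := fun v => by
      simp only [payoff, Rmax.add_finset_sup]
      refine Finset.sup_congr rfl fun k _ => ?_
      rw [add_left_comm (v k), add_left_comm]
    refine eq_of_forall_le_iff fun a => ?_
    rw [Rmax.le_coe_add_iff, le_signedOperator_iff, le_signedOperator_iff]
    simp only [hpay, Rmax.le_coe_add_iff]
  cont x y hx hy l c hc := by
    refine le_signedOperator_iff.mpr fun v hv hl => ?_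
    by_cases hcb : c = ⊥
    · simp [hcb]
    have h1 : ∀ j, ((-(v l).opp : ℝ) : Rmax) + c ≤
        (otherSide I J l).sup fun k => v k + x j k := fun j => by
      rw [← Rmax.le_coe_add_iff]
      exact le_signedOperator_iff.mp (hc j) v hv hl
    have hc' := Rmax.coe_add_ne_bot (-(v l).opp) hcb
    rw [payoff, Rmax.le_coe_add_iff]
    set c' := ((-(v l).opp : ℝ) : Rmax) + c
    -- A single `k` serves all `j`: otherwise each `k` fails from some index `f k` on, and at the
    -- largest of these indices all fail.
    obtain ⟨k, hk, hkj⟩ : ∃ k ∈ otherSide I J l, ∀ j, c' ≤ v k + x j k := by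
      by_contra! h
      choose! f hf using h
      obtain ⟨k, hk, hle⟩ := (Finset.le_sup_iff (bot_lt_iff_ne_bot.mpr hc')).mp
        (h1 ((otherSide I J l).sup f))
      exact absurd (hle.trans (add_le_add le_rfl (hx (Finset.le_sup hk) k))) (not_le.mpr (hf k hk))
    refine le_trans ?_ (Finset.le_sup (f := fun k => v k + y k) hk)
    cases hvk : v k using WithBot.recBotCoe with
    | bot => exact absurd (le_bot_iff.mp (by simpa [hvk] using hkj 0)) hc'
    | coe r =>
      rw [Rmax.le_coe_add_iff]
      refine (hy k).2 ?_
      rintro _ ⟨j, rfl⟩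
      rw [← Rmax.le_coe_add_iff, ← hvk]
      exact hkj j

/-- The infimum of the `α` for which `T^{IJ}` has a finite `α`-sub-eigenvector is attained. -/
theorem exists_sub_of_forall_lt (I J : Finset (Fin n)) (V : Finset (Fin n → Rmax))
    (hV : ∀ l, ∃ v ∈ V, v l ≠ ⊥) (α : ℝ)
    (h : ∀ ε : ℝ, 0 < ε → ∃ p : Fin n → ℝ,
      ∀ l, signedOperator I J V hV (ofReal p) l ≤ ((α + ε : ℝ) : Rmax) + p l) :
    ∃ p : Fin n → ℝ, ∀ l, signedOperator I J V hV (ofReal p) l ≤ (α : Rmax) + p l := by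
  classical
  let P : (Fin n → V) → ℝ → (Fin n → ℝ) → Prop := fun f ε p =>
    ∀ l, payoff I J (ofReal p) l (f l) ≤ ((α + ε : ℝ) : Rmax) + p l
  have hP : ∀ f ε p, P f ε p ↔ ∀ l k, (((-α + ((f l).1 l).opp : ℝ) : Rmax) +
      if k ∈ otherSide I J l then (f l).1 k else ⊥) + (p k : Rmax) ≤ (ε : Rmax) + p l := by
    intro f ε p
    refine forall_congr' fun l => ?_
    rw [payoff, Rmax.add_finset_sup, Finset.sup_le_iff]
    refine forall_congr' fun k => ?_
    by_cases hk : k ∈ otherSide I J l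
    · simp only [hk, if_true, forall_const]
      rw [add_assoc, ← Rmax.coe_add_coe_add (-α), Rmax.coe_add_le_iff (-α), neg_neg,
        Rmax.coe_add_coe_add α]
      rfl
    · simp [hk]
  -- There are finitely many policies, so one works for every `ε`: otherwise take the least failing
  -- error `e g` and the policy that is minimizing for a sub-eigenvector at that error.
  obtain ⟨f, hfl, hf⟩ : ∃ f : Fin n → V, (∀ l, (f l).1 l ≠ ⊥) ∧ ∀ ε, 0 < ε → ∃ p, P f ε p := by
    by_contra! hcon
    have hcon' : ∀ f : Fin n → V, ∃ ε : ℝ, 0 < ε ∧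
        ((∀ l, (f l).1 l ≠ ⊥) → ∀ p, ¬ P f ε p) := fun f => by
      by_cases hfl : ∀ l, (f l).1 l ≠ ⊥
      · obtain ⟨ε, hε, h⟩ := hcon f hfl
        exact ⟨ε, hε, fun _ => h⟩
      -- Inadmissible policies get an arbitrary positive error, which keeps the minimum positive.
      · exact ⟨1, one_pos, fun h => absurd h hfl⟩
    choose e he0 he using hcon'
    have hne : Nonempty (Fin n → V) := ⟨fun l => ⟨(hV l).choose, (hV l).choose_spec.1⟩⟩
    obtain ⟨g, hg⟩ := Finite.exists_min e
    obtain ⟨p, hp⟩ := h (e g) (he0 g)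
    obtain ⟨σ, hσ⟩ := exists_isMinimizer I J V hV (ofReal p)
    refine he (fun l => ⟨σ l, (hσ l).1⟩) (fun l => (hσ l).2.1) p fun l => ?_
    rw [← (hσ l).2.2]
    refine (hp l).trans ?_
    gcongr
    exact_mod_cast add_le_add le_rfl (hg _)
  obtain ⟨p, hp⟩ := exists_potential _ fun ε hε =>
    let ⟨p, hp⟩ := hf ε hε; ⟨p, (hP f ε p).mp hp⟩
  refine ⟨p, fun l => (signedOperator_le hV _ (f l).2 (hfl l)).trans ?_⟩
  have h0 : P f 0 p := (hP f 0 p).mpr fun l k => by simpa using hp l k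
  simpa using h0 l

/-- The images of `x` under the two tropical linear forms with coefficients `b` supported by `I`
and `J` differ by at most `-α`. -/
def IsBalanced (I J : Finset (Fin n)) (α : ℝ) (b x : Fin n → Rmax) : Prop :=
  (α : Rmax) + I.sup (fun i => b i + x i) ≤ J.sup (fun j => b j + x j) ∧
  (α : Rmax) + J.sup (fun j => b j + x j) ≤ I.sup (fun i => b i + x i)

/-- Moving `v l` to the left turns the inequality at `l` into a bound on one term of the form on the
side of `l`; the terms with `v l = ⊥` are absent on both sides. -/
theorem super_iff_isBalanced {I J : Finset (Fin n)} (hIJ : I ∪ J = Finset.univ) (hdisj : I ∩ J = ∅)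
    {V : Finset (Fin n → Rmax)} (hV : ∀ l, ∃ v ∈ V, v l ≠ ⊥) (α : ℝ) (b : Fin n → Rmax) :
    (∀ l, (α : Rmax) + b l ≤ signedOperator I J V hV b l) ↔ ∀ v ∈ V, IsBalanced I J α b v := by
  have hJI : ∀ l ∈ J, l ∉ I := fun l hl hI => by
    have := Finset.mem_inter.mpr ⟨hI, hl⟩
    simp [hdisj] at this
  have key : ∀ v : Fin n → Rmax, ∀ l, ∀ K : Finset (Fin n), v l ≠ ⊥ →
      ((α : Rmax) + b l ≤ ((v l).opp : Rmax) + K.sup (fun k => v k + b k) ↔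
        (α : Rmax) + (b l + v l) ≤ K.sup fun k => b k + v k) := by
    intro v l K hl
    simp only [add_comm (b _)]
    rw [Rmax.le_coe_add_iff, Rmax.coe_neg_opp hl, add_left_comm]
  simp only [le_signedOperator_iff]
  constructor
  · refine fun h v hv => ⟨?_, ?_⟩
    all_goals
      rw [Rmax.add_finset_sup]
      refine Finset.sup_le fun l hl => ?_
      by_cases hvl : v l = ⊥
      · simp [hvl]
      have := (key v l _ hvl).mp (h l v hv hvl)
    · simpa [otherSide, hl] using this
    · simpa [otherSide, hJI l hl] using this
  · intro h l v hv hvl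
    refine (key v l _ hvl).mpr ?_
    by_cases hl : l ∈ I
    · rw [otherSide, if_pos hl]
      exact (add_le_add le_rfl (Finset.le_sup (f := fun i => b i + v i) hl)).trans (h v hv).1
    · have hlJ : l ∈ J := by
        have := Finset.mem_univ l
        rw [← hIJ, Finset.mem_union] at this
        exact this.resolve_left hl
      rw [otherSide, if_neg hl]
      exact (add_le_add le_rfl (Finset.le_sup (f := fun i => b i + v i) hlJ)).trans (h v hv).2

end TropicalRegression

/-! ### Hilbert distance to a signed hyperplane -/

namespace TropicalRegression

variable {n : ℕ}

theorem hilbertDist_nonneg (x y : Fin n → Rmax) : 0 ≤ hilbertDist x y := by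
  rw [hilbertDist]
  split_ifs with h
  · exact le_rfl
  · refine le_sInf ?_
    rintro _ ⟨s, t, rfl, hst⟩
    have hx : x ≠ ⊥ := fun hx => h ⟨hx, funext fun l => by
      have := (hst l).1
      rw [Rmax.coe_add_le_iff, hx] at this
      simpa using this⟩
    obtain ⟨l, hl⟩ := Function.ne_iff.mp hx
    obtain ⟨r, hr⟩ := WithBot.ne_bot_iff_exists.mp hl
    have h1 := hst l
    rw [← hr] at h1
    cases hy : y l using WithBot.recBotCoe with
    | bot => simp [hy] at h1
    | coe a =>
      rw [hy] at h1
      norm_cast at h1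
      exact_mod_cast (by linarith : (0 : ℝ) ≤ s - t)

theorem hilbertDist_le {x y : Fin n → Rmax} {s t : ℝ} (hst : t ≤ s)
    (h : ∀ l, (t : Rmax) + y l ≤ x l ∧ x l ≤ (s : Rmax) + y l) :
    hilbertDist x y ≤ ((s - t : ℝ) : EReal) := by
  rw [hilbertDist]
  split_ifs
  · exact_mod_cast sub_nonneg.mpr hst
  · exact sInf_le ⟨s, t, rfl, h⟩

/-- Balance is a closed condition in `r`, so the infimum in the distance need not be attained. -/
theorem isBalanced_of_forall_lt {I J : Finset (Fin n)} {r : ℝ} {b x : Fin n → Rmax}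
    (h : ∀ r' : ℝ, r < r' → IsBalanced I J (-r') b x) : IsBalanced I J (-r) b x := by
  constructor <;> rw [← Rmax.le_coe_add_iff] <;>
    refine Rmax.le_coe_add_of_forall_lt fun r' hr' => ?_ <;> rw [Rmax.le_coe_add_iff]
  exacts [(h r' hr').1, (h r' hr').2]

/-- The bounds `t + y ≤ x ≤ s + y` pass to both forms, which agree at `y`. -/
theorem isBalanced_of_hilbertDist_lt {I J : Finset (Fin n)} {r : ℝ}
    {b x y : Fin n → Rmax} (hy : y ∈ signedHyperplane I J b)
    (h : hilbertDist x y < (r : EReal)) : IsBalanced I J (-r) b x := by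
  rw [hilbertDist] at h
  split_ifs at h with hxy
  · have h0 : ∀ K : Finset (Fin n), (K.sup fun k => b k + x k) = ⊥ := fun K => by simp [hxy.1]
    constructor <;> simp only [h0] <;> simp
  · obtain ⟨_, ⟨s, t, rfl, hst⟩, hlt⟩ := sInf_lt_iff.mp h
    rw [EReal.coe_lt_coe_iff] at hlt
    have h1 : ∀ K : Finset (Fin n), ((-s : ℝ) : Rmax) + (K.sup fun k => b k + x k) ≤
        K.sup fun k => b k + y k := fun K => by
      rw [Rmax.add_finset_sup]
      refine Finset.sup_mono_fun fun k _ => ?_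
      rw [add_left_comm]
      exact add_le_add le_rfl ((Rmax.le_coe_add_iff _ _ _).mp (hst k).2)
    have h2 : ∀ K : Finset (Fin n), (t : Rmax) + (K.sup fun k => b k + y k) ≤
        K.sup fun k => b k + x k := fun K => by
      rw [Rmax.add_finset_sup]
      refine Finset.sup_mono_fun fun k _ => ?_
      rw [add_left_comm]
      exact add_le_add le_rfl (hst k).1
    have h3 : ∀ K L : Finset (Fin n),
        (K.sup fun k => b k + y k) = (L.sup fun k => b k + y k) →
        ((-r : ℝ) : Rmax) + (K.sup fun k => b k + x k) ≤ L.sup fun k => b k + x k := by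
      intro K L hKL
      calc ((-r : ℝ) : Rmax) + (K.sup fun k => b k + x k)
          ≤ ((t + -s : ℝ) : Rmax) + (K.sup fun k => b k + x k) := by
            gcongr
            exact_mod_cast (by linarith : -r ≤ t + -s)
        _ = (t : Rmax) + (((-s : ℝ) : Rmax) + (K.sup fun k => b k + x k)) := by
            rw [Rmax.coe_add_coe_add]
        _ ≤ (t : Rmax) + (L.sup fun k => b k + y k) := by
            rw [← hKL]; exact add_le_add le_rfl (h1 K)
        _ ≤ _ := h2 L
    exact ⟨h3 I J hy, h3 J I (Eq.symm hy)⟩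

/-- Lowering `x` on the side `L` of the larger form by the difference of the two forms lands on the
hyperplane. -/
theorem exists_hilbertDist_le_of_sup_le {K L : Finset (Fin n)} (hKL : K ∩ L = ∅)
    {r : ℝ} (hr : 0 ≤ r) {b x : Fin n → Rmax}
    (h : ((-r : ℝ) : Rmax) + (L.sup fun k => b k + x k) ≤ K.sup fun k => b k + x k)
    (hle : (K.sup fun k => b k + x k) ≤ L.sup fun k => b k + x k) :
    ∃ y, ((K.sup fun k => b k + y k) = L.sup fun k => b k + y k) ∧
      hilbertDist x y ≤ (r : EReal) := by
  cases hβ : (L.sup fun k => b k + x k) using WithBot.recBotCoe with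
  | bot =>
    refine ⟨x, ?_, ?_⟩
    · rw [hβ] at hle
      rw [hβ, le_bot_iff.mp hle]
    · refine (hilbertDist_le (s := 0) (t := 0) le_rfl fun l => by simp).trans ?_
      simpa using hr
  | coe β =>
    cases hα : (K.sup fun k => b k + x k) using WithBot.recBotCoe with
    | bot => rw [hα, hβ] at h; simp [← WithBot.coe_add] at h
    | coe α =>
      rw [hα, hβ] at h hle
      norm_cast at h hle
      refine ⟨fun k => if k ∈ L then ((α - β : ℝ) : Rmax) + x k else x k, ?_, ?_⟩
      · trans (α : Rmax)
        · rw [← hα]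
          refine Finset.sup_congr rfl fun k hk => ?_
          have : k ∉ L := fun hL => by
            have := Finset.mem_inter.mpr ⟨hk, hL⟩
            simp [hKL] at this
          simp [this]
        · trans ((α - β : ℝ) : Rmax) + (L.sup fun k => b k + x k)
          · rw [hβ]; norm_cast; ring
          · rw [Rmax.add_finset_sup]
            refine Finset.sup_congr rfl fun k hk => ?_
            simp only [if_pos hk]
            rw [add_left_comm]
      · refine (hilbertDist_le (s := β - α) (t := 0) (by linarith) fun l => ?_).trans
          (EReal.coe_le_coe_iff.mpr (by linarith))
        split_ifs
        · constructor
          · rw [Rmax.coe_add_coe_add]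
            exact Rmax.coe_add_le_self_of_nonpos (by linarith) _
          · rw [Rmax.coe_add_coe_add]; simp
        · refine ⟨by simp, ?_⟩
          rw [Rmax.le_coe_add_iff]
          exact Rmax.coe_add_le_self_of_nonpos (by linarith) _

theorem iInf_hilbertDist_le_iff {I J : Finset (Fin n)} (hdisj : I ∩ J = ∅) {r : ℝ} (hr : 0 ≤ r)
    (b x : Fin n → Rmax) :
    ⨅ y ∈ signedHyperplane I J b, hilbertDist x y ≤ (r : EReal) ↔ IsBalanced I J (-r) b x := by
  constructor
  · refine fun h => isBalanced_of_forall_lt fun r' hr' => ?_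
    obtain ⟨y, hy⟩ := iInf_lt_iff.mp (h.trans_lt (EReal.coe_lt_coe_iff.mpr hr'))
    obtain ⟨hyb, hlt⟩ := iInf_lt_iff.mp hy
    exact isBalanced_of_hilbertDist_lt hyb hlt
  · rintro ⟨h1, h2⟩
    rcases le_total (I.sup fun k => b k + x k) (J.sup fun k => b k + x k) with hle | hle
    · obtain ⟨y, hy, hd⟩ := exists_hilbertDist_le_of_sup_le hdisj hr h2 hle
      exact (iInf₂_le y hy).trans hd
    · rw [Finset.inter_comm] at hdisj
      obtain ⟨y, hy, hd⟩ := exists_hilbertDist_le_of_sup_le hdisj hr h1 hle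
      exact (iInf₂_le y hy.symm).trans hd

theorem hilbertDistSet_le_iff {I J : Finset (Fin n)} (hIJ : I ∪ J = Finset.univ) (hdisj : I ∩ J = ∅)
    {V : Finset (Fin n → Rmax)} (hV : ∀ l, ∃ v ∈ V, v l ≠ ⊥) {r : ℝ} (hr : 0 ≤ r)
    (b : Fin n → Rmax) :
    hilbertDistSet (V : Set (Fin n → Rmax)) (signedHyperplane I J b) ≤ (r : EReal) ↔
      ∀ l, ((-r : ℝ) : Rmax) + b l ≤ signedOperator I J V hV b l := by
  rw [super_iff_isBalanced hIJ hdisj hV, hilbertDistSet, iSup₂_le_iff]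
  simp only [iInf_hilbertDist_le_iff hdisj hr, Finset.mem_coe]

theorem hilbertDistSet_nonneg {A B : Set (Fin n → Rmax)} (hA : A.Nonempty) :
    0 ≤ hilbertDistSet A B := by
  obtain ⟨x, hx⟩ := hA
  exact (le_iInf₂ fun y _ => hilbertDist_nonneg x y).trans
    (le_iSup₂ (f := fun a (_ : a ∈ A) => ⨅ b ∈ B, hilbertDist a b) x hx)

/-! ### Vertical intervals in the span -/

theorem isTropicalCone_tropicalSpan (V : Set (Fin n → Rmax)) :
    IsTropicalCone (tropicalSpan V) := fun x hx y hy β =>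
  ⟨fun C hC => (hC.1 x (hx C hC) y (hy C hC) β).1,
    fun C hC => (hC.1 x (hx C hC) y (hy C hC) β).2⟩

theorem subset_tropicalSpan (V : Set (Fin n → Rmax)) : V ⊆ tropicalSpan V :=
  Set.subset_sInter fun _ hC => hC.2

/-- Both forms are max-plus linear; hence balance on `V` extends to its span. -/
theorem isTropicalCone_isBalanced (I J : Finset (Fin n)) (α : ℝ) (b : Fin n → Rmax) :
    IsTropicalCone {x | IsBalanced I J α b x} := by
  have hadd : ∀ (K : Finset (Fin n)) (β : Rmax) (x : Fin n → Rmax),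
      (K.sup fun k => b k + (β + x k)) = β + K.sup fun k => b k + x k := fun K β x => by
    rw [Rmax.add_finset_sup]
    exact Finset.sup_congr rfl fun k _ => add_left_comm _ _ _
  have hsup : ∀ (K : Finset (Fin n)) (x y : Fin n → Rmax),
      (K.sup fun k => b k + (x ⊔ y) k) =
        (K.sup fun k => b k + x k) ⊔ K.sup fun k => b k + y k := fun K x y => by
    rw [← Finset.sup_sup]
    exact Finset.sup_congr rfl fun k _ => (add_right_mono (a := b k)).map_sup _ _
  have hα : Monotone fun a : Rmax => (α : Rmax) + a := add_right_mono
  rintro x ⟨hx1, hx2⟩ y ⟨hy1, hy2⟩ β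
  refine ⟨⟨?_, ?_⟩, ⟨?_, ?_⟩⟩
  · rw [hadd, hadd, add_left_comm]; exact add_le_add le_rfl hx1
  · rw [hadd, hadd, add_left_comm]; exact add_le_add le_rfl hx2
  · rw [hsup, hsup, hα.map_sup]; exact sup_le_sup hx1 hy1
  · rw [hsup, hsup, hα.map_sup]; exact sup_le_sup hx2 hy2

theorem mem_right_iff {I J : Finset (Fin n)} (hIJ : I ∪ J = Finset.univ) (hdisj : I ∩ J = ∅)
    (l : Fin n) : l ∈ J ↔ l ∉ I := by
  constructor
  · intro hl hI
    have := Finset.mem_inter.mpr ⟨hI, hl⟩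
    simp [hdisj] at this
  · intro hl
    have := Finset.mem_univ l
    rw [← hIJ, Finset.mem_union] at this
    exact this.resolve_left hl

theorem super_le_neg_radius {I J : Finset (Fin n)} (hIJ : I ∪ J = Finset.univ) (hdisj : I ∩ J = ∅)
    {V : Finset (Fin n → Rmax)} (hV : ∀ l, ∃ v ∈ V, v l ≠ ⊥) {α r : ℝ} (hr : 0 ≤ r)
    {b : Fin n → Rmax} (hb : b ≠ ⊥) (hα : ∀ l, (α : Rmax) + b l ≤ signedOperator I J V hV b l)
    {w : Fin n → ℝ} (hw : verticalInterval J w r ⊆ tropicalSpan (V : Set (Fin n → Rmax))) :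
    α ≤ -r := by
  have hbal : ∀ x ∈ tropicalSpan (V : Set (Fin n → Rmax)), IsBalanced I J α b x :=
    Set.sInter_subset_of_mem ⟨isTropicalCone_isBalanced I J α b,
      (super_iff_isBalanced hIJ hdisj hV α b).mp hα⟩
  have hsupI : ∀ μ : ℝ, (I.sup fun i => b i + ofReal
      (fun l => 0 + w l + μ * (if l ∈ J then 1 else 0)) i) = I.sup fun i => b i + w i :=
    fun μ => Finset.sup_congr rfl fun i hi => by
      have : i ∉ J := fun h => (mem_right_iff hIJ hdisj i).mp h hi
      simp [ofReal, this]
  have hsupJ : ∀ μ : ℝ, (J.sup fun j => b j + ofReal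
      (fun l => 0 + w l + μ * (if l ∈ J then 1 else 0)) j) =
        (μ : Rmax) + J.sup fun j => b j + w j := fun μ => by
    rw [Rmax.add_finset_sup]
    refine Finset.sup_congr rfl fun j hj => ?_
    rw [add_left_comm]
    simp only [ofReal, hj, if_true]
    norm_cast
    congr 2
    ring
  -- Between the ends `μ = r` and `μ = -r` the `J`-form moves by `2 * r` while the `I`-form stays
  -- fixed, and balance allows a total variation of `-2 * α`.
  have h1 := (hbal _ (hw ⟨0, r, by linarith, le_rfl, rfl⟩)).2
  have h2 := (hbal _ (hw ⟨0, -r, le_rfl, by linarith, rfl⟩)).1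
  rw [hsupI, hsupJ] at h1 h2
  obtain ⟨l, hl⟩ := Function.ne_iff.mp hb
  have hne : (I.sup fun i => b i + (w i : Rmax)) ≠ ⊥ ∨ (J.sup fun j => b j + (w j : Rmax)) ≠ ⊥ := by
    have hlw : b l + (w l : Rmax) ≠ ⊥ := by rw [add_comm]; exact Rmax.coe_add_ne_bot _ hl
    by_cases hlI : l ∈ I
    · exact Or.inl (ne_bot_of_le_ne_bot hlw (Finset.le_sup (f := fun i => b i + (w i : Rmax)) hlI))
    · exact Or.inr (ne_bot_of_le_ne_bot hlw (Finset.le_sup (f := fun i => b i + (w i : Rmax))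
        ((mem_right_iff hIJ hdisj l).mpr hlI)))
  generalize (I.sup fun i => b i + (w i : Rmax)) = p at h1 h2 hne
  generalize (J.sup fun i => b i + (w i : Rmax)) = q at h1 h2 hne
  cases p using WithBot.recBotCoe with
  | bot =>
    cases q using WithBot.recBotCoe with
    | bot => simp at hne
    | coe q => simp [← WithBot.coe_add] at h1
  | coe p =>
    cases q using WithBot.recBotCoe with
    | bot => simp [← WithBot.coe_add] at h2
    | coe q =>
      norm_cast at h1 h2
      linarith

theorem finset_sup_mem_tropicalSpan {V : Set (Fin n → Rmax)} (hV : V.Nonempty) {ι : Type*}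
    (K : Finset ι) (z : ι → Fin n → Rmax) (hz : ∀ k ∈ K, z k ∈ tropicalSpan V) :
    K.sup z ∈ tropicalSpan V := by
  have hcone := isTropicalCone_tropicalSpan V
  refine Finset.sup_induction (p := fun x => x ∈ tropicalSpan V) ?_
    (fun x hx y hy => (hcone x hx y hy 0).2) hz
  -- The empty supremum `⊥` is the multiple of some `v` by the scalar `-∞`.
  obtain ⟨v, hv⟩ := hV
  have := (hcone v (subset_tropicalSpan V hv) v (subset_tropicalSpan V hv) ⊥).1
  simp only [WithBot.bot_add] at this
  exact this

theorem verticalInterval_center_subset {I J : Finset (Fin n)} (hIJ : I ∪ J = Finset.univ)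
    (hdisj : I ∩ J = ∅) {V : Finset (Fin n → Rmax)} (hV : ∀ l, ∃ v ∈ V, v l ≠ ⊥) {α : ℝ}
    (hne : (V : Set (Fin n → Rmax)).Nonempty)
    {u : Fin n → ℝ} (hu : ∀ l, signedOperator I J V hV (ofReal u) l ≤ (α : Rmax) + (u l : Rmax))
    {σ : Fin n → (Fin n → Rmax)} (hσ : IsMinimizer I J V hV (ofReal u) σ) :
    ∃ c : Fin n → ℝ, ofReal c = center I J u σ ∧
      verticalInterval J c (-α) ⊆ tropicalSpan (V : Set (Fin n → Rmax)) := by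
  have hcone := isTropicalCone_tropicalSpan (V : Set (Fin n → Rmax))
  -- `z k` is `σ k` scaled to have entry `-u k` at `k`; the inequality for `u` then bounds its
  -- entries on the opposite side by `α - u l`, hence by `α + c l`.
  set z : Fin n → Fin n → Rmax := fun k l => ((-(u k) + (σ k k).opp : ℝ) : Rmax) + σ k l with hz
  have hzV : ∀ k, z k ∈ tropicalSpan (V : Set (Fin n → Rmax)) := fun k =>
    (hcone _ (subset_tropicalSpan _ (hσ k).1) _ (subset_tropicalSpan _ (hσ k).1) _).1
  have hzsup : ∀ K : Finset (Fin n), K.sup z ∈ tropicalSpan (V : Set (Fin n → Rmax)) := fun K => by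
    exact finset_sup_mem_tropicalSpan hne K z fun k _ => hzV k
  have hzkk : ∀ k, z k k = ((-(u k) : ℝ) : Rmax) := fun k => by
    rw [hz]
    dsimp only
    rw [← Rmax.coe_add_coe_add, Rmax.coe_opp (hσ k).2.1, add_zero]
  have hcen : ∀ l, center I J u σ l = (if l ∈ I then I else J).sup fun k => z k l := fun l => rfl
  have hlow : ∀ l, ((-(u l) : ℝ) : Rmax) ≤ center I J u σ l := fun l => by
    rw [hcen, ← hzkk]
    refine Finset.le_sup (f := fun k => z k l) ?_
    split_ifs with h
    · exact h
    · exact (mem_right_iff hIJ hdisj l).mpr h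
  have hcross : ∀ k, ∀ l ∈ otherSide I J k, z k l ≤ (α : Rmax) + center I J u σ l := by
    intro k l hl
    refine le_trans ?_ (add_le_add le_rfl (hlow l))
    have h1 := hu k
    rw [(hσ k).2.2, payoff, Rmax.add_finset_sup, Finset.sup_le_iff] at h1
    have h2 := h1 l hl
    simp only [hz]
    cases h : σ k l using WithBot.recBotCoe with
    | bot => simp
    | coe a =>
      simp only [h, ofReal] at h2
      norm_cast at h2 ⊢
      linarith
  choose c hc using fun l => WithBot.ne_bot_iff_exists.mp
    (ne_bot_of_le_ne_bot WithBot.coe_ne_bot (hlow l))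
  refine ⟨c, funext hc, ?_⟩
  rintro _ ⟨s, μ, hμ1, hμ2, rfl⟩
  -- The supremum of the `z k` over one side equals `c` there and is at most `α + c` on the other.
  -- With relative shift `μ` between `α` and `-α`, each of the two suprema dominates on its own
  -- side.
  have hmem := (hcone _ (hcone _ (hzsup I) _ (hzsup I) (s : Rmax)).1
    _ (hcone _ (hzsup J) _ (hzsup J) ((s + μ : ℝ) : Rmax)).1 0).2
  convert hmem using 1
  funext l
  simp only [Pi.sup_apply, Finset.sup_apply]
  by_cases hl : l ∈ I
  · have hlJ : l ∉ J := fun h => (mem_right_iff hIJ hdisj l).mp h hl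
    have hJl : (J.sup fun k => z k l) ≤ (α : Rmax) + c l := Finset.sup_le fun k hk => by
      rw [hc]
      refine hcross k l ?_
      rwa [otherSide, if_neg ((mem_right_iff hIJ hdisj k).mp hk)]
    have hIl : (I.sup fun k => z k l) = c l := by rw [hc, hcen, if_pos hl]
    rw [hIl, sup_eq_left.mpr]
    · simp [ofReal, hlJ]
    · refine (add_le_add le_rfl hJl).trans ?_
      norm_cast
      linarith
  · have hlJ : l ∈ J := (mem_right_iff hIJ hdisj l).mpr hl
    have hIl : (I.sup fun k => z k l) ≤ (α : Rmax) + c l := Finset.sup_le fun k hk => by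
      rw [hc]
      refine hcross k l ?_
      rwa [otherSide, if_pos hk]
    have hJl : (J.sup fun k => z k l) = c l := by rw [hc, hcen, if_neg hl]
    rw [hJl, sup_eq_right.mpr]
    · simp only [ofReal, hlJ, if_true]
      norm_cast
      ring
    · refine (add_le_add le_rfl hIl).trans ?_
      norm_cast
      linarith

/-- Some `v` makes one of the two forms finite; chaining the two balance inequalities then gives `2
* α ≤ 0`. -/
theorem super_nonpos {I J : Finset (Fin n)} (hIJ : I ∪ J = Finset.univ) (hdisj : I ∩ J = ∅)
    {V : Finset (Fin n → Rmax)} (hV : ∀ l, ∃ v ∈ V, v l ≠ ⊥) {α : ℝ}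
    {b : Fin n → Rmax} (hb : b ≠ ⊥) (hα : ∀ l, (α : Rmax) + b l ≤ signedOperator I J V hV b l) :
    α ≤ 0 := by
  obtain ⟨l, hl⟩ := Function.ne_iff.mp hb
  obtain ⟨v, hv, hvl⟩ := hV l
  obtain ⟨h1, h2⟩ := (super_iff_isBalanced hIJ hdisj hV α b).mp hα v hv
  have hlv : b l + v l ≠ ⊥ := fun h => (WithBot.add_eq_bot.mp h).elim hl hvl
  have hne : (I.sup fun i => b i + v i) ≠ ⊥ ∨ (J.sup fun j => b j + v j) ≠ ⊥ := by
    by_cases hlI : l ∈ I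
    · exact Or.inl (ne_bot_of_le_ne_bot hlv (Finset.le_sup (f := fun i => b i + v i) hlI))
    · exact Or.inr (ne_bot_of_le_ne_bot hlv (Finset.le_sup (f := fun i => b i + v i)
        ((mem_right_iff hIJ hdisj l).mpr hlI)))
  generalize (I.sup fun i => b i + v i) = p at h1 h2 hne
  generalize (J.sup fun i => b i + v i) = q at h1 h2 hne
  cases p using WithBot.recBotCoe with
  | bot =>
    cases q using WithBot.recBotCoe with
    | bot => simp at hne
    | coe q => simp [← WithBot.coe_add] at h2
  | coe p =>
    cases q using WithBot.recBotCoe with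
    | bot => simp [← WithBot.coe_add] at h1
    | coe q =>
      norm_cast at h1 h2
      linarith

/-- Either `T^{IJ}` has no super-eigenvector for a real scalar, or there is a largest such scalar,
and it is an eigenvalue. -/
theorem spectralRad_cases {I J : Finset (Fin n)} (hIJ : I ∪ J = Finset.univ) (hdisj : I ∩ J = ∅)
    {V : Finset (Fin n → Rmax)} (hV : ∀ l, ∃ v ∈ V, v l ≠ ⊥) :
    (spectralRad (signedOperator I J V hV) = ⊥ ∧
      (∀ α : ℝ, ∀ b : Fin n → Rmax, b ≠ ⊥ →
        ¬ ∀ l, (α : Rmax) + b l ≤ signedOperator I J V hV b l) ∧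
      ∀ α : ℝ, ∃ u : Fin n → ℝ,
        ∀ l, signedOperator I J V hV (ofReal u) l ≤ (α : Rmax) + (u l : Rmax)) ∨
    ∃ ρ : ℝ, spectralRad (signedOperator I J V hV) = (ρ : EReal) ∧
      (∃ b : Fin n → Rmax, b ≠ ⊥ ∧ ∀ l, (ρ : Rmax) + b l ≤ signedOperator I J V hV b l) ∧
      ∃ u : Fin n → ℝ,
        ∀ l, signedOperator I J V hV (ofReal u) l ≤ (ρ : Rmax) + (u l : Rmax) := by
  set T := signedOperator I J V hV with hTdef
  have hT : IsShapley T := isShapley_signedOperator I J V hV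
  set A : Set ℝ := {α | ∃ b : Fin n → Rmax, b ≠ ⊥ ∧ ∀ l, (α : Rmax) + b l ≤ T b l} with hA
  have hbdd : BddAbove A := ⟨0, fun α ⟨b, hb, hα⟩ => super_nonpos hIJ hdisj hV hb hα⟩
  have heig : ∀ (α : ℝ) (u : Fin n → Rmax), u ≠ ⊥ → (T u = fun l => (α : Rmax) + u l) → α ∈ A :=
    fun α u hu h => ⟨u, hu, fun l => (congrFun h l).ge⟩
  by_cases hne : A.Nonempty
  · right
    set ρ := sSup A
    have hlub : IsLUB A ρ := isLUB_csSup hne hbdd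
    have hρ : ρ ∈ A := by
      rcases hT.exists_super_or_sub ρ with h | ⟨δ, hδ, p, hp⟩
      · exact h
      -- A finite sub-eigenvector for `ρ - δ` would bound all of `A` by `ρ - δ`.
      · have : ρ ≤ ρ - δ := hlub.2 fun α ⟨b, hb, hα⟩ => hT.super_le_sub hb hα hp
        linarith
    obtain ⟨u, hu⟩ := exists_sub_of_forall_lt I J V hV ρ fun ε hε => by
      rcases hT.exists_super_or_sub (ρ + ε) with h | ⟨δ, hδ, p, hp⟩
      · have := hlub.1 h
        linarith
      · refine ⟨p, fun l => (hp l).trans ?_⟩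
        gcongr
        exact_mod_cast (by linarith : ρ + ε - δ ≤ ρ + ε)
    obtain ⟨b, hb, hbρ⟩ := hρ
    refine ⟨ρ, ?_, ⟨b, hb, hbρ⟩, u, hu⟩
    obtain ⟨e, he, heρ⟩ := hT.exists_eigenvector hb hbρ hu
    refine le_antisymm (sSup_le ?_) (le_sSup ⟨ρ, rfl, e, he, heρ⟩)
    rintro _ ⟨α, rfl, x, hx, h⟩
    cases α using WithBot.recBotCoe with
    | bot => simp
    | coe α => exact EReal.coe_le_coe_iff.mpr (hlub.1 (heig α x hx h))
  · left
    have hno : ∀ α : ℝ, α ∉ A := fun α hα => hne ⟨α, hα⟩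
    refine ⟨le_bot_iff.mp (sSup_le ?_), fun α b hb h => hno α ⟨b, hb, h⟩, fun α => ?_⟩
    · rintro _ ⟨α, rfl, x, hx, h⟩
      cases α using WithBot.recBotCoe with
      | bot => simp
      | coe α => exact absurd (heig α x hx h) (hno α)
    · rcases hT.exists_super_or_sub α with h | ⟨δ, hδ, p, hp⟩
      · exact absurd h (hno α)
      · refine ⟨p, fun l => (hp l).trans ?_⟩
        gcongr
        exact_mod_cast (by linarith : α - δ ≤ α)

end TropicalRegression
-- The duality theorem
open TropicalRegression in
theorem mainTheorem5 (n : ℕ) (I J : Finset (Fin n)) (hI : I.Nonempty) (hJ : J.Nonempty)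
    (hIJ : I ∪ J = Finset.univ) (hdisj : I ∩ J = ∅)
    (V : Finset (Fin n → Rmax)) (hV : ∀ l, ∃ v ∈ V, v l ≠ ⊥) :
    -- the minimal distance is attained and equals `-ρ`
    IsLeast {c : EReal | ∃ a : Fin n → Rmax, a ≠ ⊥ ∧
        c = hilbertDistSet (V : Set (Fin n → Rmax)) (signedHyperplane I J a)}
      (-spectralRad (signedOperator I J V hV)) ∧
    -- `-ρ` is the supremum of the radii of the vertical intervals contained in the span
    -spectralRad (signedOperator I J V hV) =
      sSup {c : EReal | ∃ r : ℝ, c = (r : EReal) ∧ 0 ≤ r ∧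
        ∃ w : Fin n → ℝ, verticalInterval J w r ⊆ tropicalSpan (V : Set (Fin n → Rmax))} ∧
    -- vectors `b` with `T(b) ≥ ρ + b` exist, and all of them attain the minimum
    (∃ b : Fin n → Rmax, b ≠ ⊥ ∧
      ∀ l, spectralRad (signedOperator I J V hV) + (b l).toEReal ≤
        (signedOperator I J V hV b l).toEReal) ∧
    (∀ b : Fin n → Rmax, b ≠ ⊥ →
      (∀ l, spectralRad (signedOperator I J V hV) + (b l).toEReal ≤
        (signedOperator I J V hV b l).toEReal) →
      hilbertDistSet (V : Set (Fin n → Rmax)) (signedHyperplane I J b) =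
        -spectralRad (signedOperator I J V hV)) ∧
    -- if `ρ` is finite, the supremum is attained by intervals built from finite vectors `u`
    -- with `T(u) ≤ ρ + u`, and such vectors exist
    (∀ ρ : ℝ, spectralRad (signedOperator I J V hV) = (ρ : EReal) →
      IsGreatest {r : ℝ | 0 ≤ r ∧
        ∃ w : Fin n → ℝ, verticalInterval J w r ⊆ tropicalSpan (V : Set (Fin n → Rmax))} (-ρ) ∧
      (∃ u : Fin n → ℝ, ∀ l, signedOperator I J V hV (ofReal u) l ≤ (ρ : Rmax) + (u l : Rmax)) ∧
      (∀ u : Fin n → ℝ,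
        (∀ l, signedOperator I J V hV (ofReal u) l ≤ (ρ : Rmax) + (u l : Rmax)) →
        (∃ σ : Fin n → (Fin n → Rmax), IsMinimizer I J V hV (ofReal u) σ) ∧
        ∀ σ : Fin n → (Fin n → Rmax), IsMinimizer I J V hV (ofReal u) σ →
          ∃ c : Fin n → ℝ, ofReal c = center I J u σ ∧
            verticalInterval J c (-ρ) ⊆ tropicalSpan (V : Set (Fin n → Rmax)))) := by
  set T := signedOperator I J V hV with hTdef
  have hVne : (V : Set (Fin n → Rmax)).Nonempty :=
    let ⟨l, _⟩ := hI; let ⟨v, hv, _⟩ := hV l; ⟨v, hv⟩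
  have hreal : ∀ (ρ : ℝ) (b : Fin n → Rmax),
      (∀ l, (ρ : EReal) + (b l).toEReal ≤ (T b l).toEReal) ↔
        ∀ l, (ρ : Rmax) + b l ≤ T b l := fun ρ b => by
    simp only [← Rmax.toEReal_coe_add, Rmax.toEReal_le_iff]
  have hint : ∀ (ρ : ℝ) (u : Fin n → ℝ), (∀ l, T (ofReal u) l ≤ (ρ : Rmax) + (u l : Rmax)) →
      ∃ w : Fin n → ℝ, verticalInterval J w (-ρ) ⊆ tropicalSpan (V : Set (Fin n → Rmax)) :=
    fun ρ u hu =>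
      let ⟨σ, hσ⟩ := exists_isMinimizer I J V hV (ofReal u)
      let ⟨c, _, hc⟩ := verticalInterval_center_subset hIJ hdisj hV hVne hu hσ
      ⟨c, hc⟩
  rcases spectralRad_cases hIJ hdisj hV with ⟨hρ, hno, hsub⟩ | ⟨ρ, hρ, ⟨b, hb, hbρ⟩, u, hu⟩
  · rw [← hTdef] at hρ hno hsub
    have htop : ∀ a : Fin n → Rmax, a ≠ ⊥ →
        hilbertDistSet (V : Set (Fin n → Rmax)) (signedHyperplane I J a) = ⊤ := by
      intro a ha
      by_contra hlt
      have h0 := hilbertDistSet_nonneg (B := signedHyperplane I J a) hVne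
      lift hilbertDistSet (V : Set (Fin n → Rmax)) (signedHyperplane I J a) to ℝ using
        ⟨hlt, ne_bot_of_le_ne_bot EReal.zero_ne_bot h0⟩ with r hr
      exact hno (-r) a ha ((hilbertDistSet_le_iff hIJ hdisj hV (by exact_mod_cast h0) a).mp hr.ge)
    have hone : (fun _ => 0 : Fin n → Rmax) ≠ ⊥ := fun h =>
      let ⟨l, _⟩ := hI; WithBot.coe_ne_bot (congrFun h l)
    -- For `ρ = -∞` the condition `T(b) ≥ ρ + b` is vacuous, so every `b ≠ ⊥` qualifies.
    simp only [hρ, EReal.neg_bot, EReal.bot_add, bot_le, implies_true, and_true, true_implies]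
    refine ⟨⟨⟨_, hone, (htop _ hone).symm⟩, ?_⟩, ?_, ⟨_, hone⟩, htop, ?_⟩
    · rintro _ ⟨a, ha, rfl⟩
      exact (htop a ha).ge
    · refine (EReal.eq_top_iff_forall_lt _).mpr (fun r => ?_) |>.symm
      obtain ⟨u, hu⟩ := hsub (-(|r| + 1))
      obtain ⟨w, hw⟩ := hint _ u hu
      rw [neg_neg] at hw
      refine lt_of_lt_of_le ?_ (le_sSup ⟨|r| + 1, rfl, by positivity, w, hw⟩)
      exact EReal.coe_lt_coe_iff.mpr (by linarith [le_abs_self r])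
    · intro ρ h
      exact absurd h.symm (EReal.coe_ne_bot ρ)
  · rw [← hTdef] at hρ hbρ hu
    have hρ0 : 0 ≤ -ρ := neg_nonneg.mpr (super_nonpos hIJ hdisj hV hb hbρ)
    have hT := isShapley_signedOperator I J V hV
    have hge : ∀ a : Fin n → Rmax, a ≠ ⊥ → ((-ρ : ℝ) : EReal) ≤
        hilbertDistSet (V : Set (Fin n → Rmax)) (signedHyperplane I J a) := by
      intro a ha
      by_contra! hlt
      have h0 := hilbertDistSet_nonneg (B := signedHyperplane I J a) hVne
      lift hilbertDistSet (V : Set (Fin n → Rmax)) (signedHyperplane I J a) to ℝ using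
        ⟨hlt.ne_top, ne_bot_of_le_ne_bot EReal.zero_ne_bot h0⟩ with r hr
      have := hT.super_le_sub ha
        ((hilbertDistSet_le_iff hIJ hdisj hV (by exact_mod_cast h0) a).mp hr.ge) hu
      rw [EReal.coe_lt_coe_iff] at hlt
      linarith
    have heq : ∀ a : Fin n → Rmax, a ≠ ⊥ → (∀ l, (ρ : Rmax) + a l ≤ T a l) →
        hilbertDistSet (V : Set (Fin n → Rmax)) (signedHyperplane I J a) = ((-ρ : ℝ) : EReal) :=
      fun a ha h => le_antisymm
        ((hilbertDistSet_le_iff hIJ hdisj hV hρ0 a).mpr (by simpa using h)) (hge a ha)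
    have hgreat : IsGreatest {r : ℝ | 0 ≤ r ∧ ∃ w : Fin n → ℝ,
        verticalInterval J w r ⊆ tropicalSpan (V : Set (Fin n → Rmax))} (-ρ) := by
      refine ⟨⟨hρ0, hint ρ u hu⟩, fun r ⟨hr, w, hw⟩ => ?_⟩
      linarith [super_le_neg_radius hIJ hdisj hV hr hb hbρ hw]
    simp only [hρ, hreal, ← EReal.coe_neg]
    refine ⟨⟨⟨b, hb, (heq b hb hbρ).symm⟩, ?_⟩, ?_, ⟨b, hb, hbρ⟩, heq, ?_⟩
    · rintro _ ⟨a, ha, rfl⟩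
      exact hge a ha
    · refine le_antisymm (le_sSup ⟨-ρ, rfl, hgreat.1⟩) (sSup_le ?_)
      rintro _ ⟨r, rfl, hr⟩
      exact EReal.coe_le_coe_iff.mpr (hgreat.2 hr)
    · intro ρ' h
      obtain rfl := EReal.coe_injective h
      exact ⟨hgreat, ⟨u, hu⟩, fun u' hu' => ⟨exists_isMinimizer I J V hV (ofReal u'),
        fun σ hσ => verticalInterval_center_subset hIJ hdisj hV hVne hu' hσ⟩⟩
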